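/- Let $\mathbf{Cat}$ be the category of small categories. For a functor $F:\mathbb A\to\mathbb B$ let $\mathsf MF$ be the category whose objects are pairs $(A,\,x:B\cong FA)$ with $A\in\mathbb A$ and $x$ an isomorphism of $\mathbb B$, and whose arrows $(A,x)\to(A',x')$ are pairs $(b:B\to B',\,a:A\to A')$ with $x'b=F(a)\,x$. Let $\mathsf RF:\mathsf MF\to\mathbb B$, $(A,x:B\cong FA)\mapsto B$, and let $\mathsf R$ be the resulting monad on the arrow category $\mathbf{Cat}^{\mathbf 2}$, with unit $A\mapsto(A,\mathrm{id}_{FA})$ and multiplication $((A,x:B\cong FA),x':B'\cong B)\mapsto(A,xx')$. An $\mathsf R$-algebra is a functor $F:\mathbb A\to\mathbb B$ with a structure functor $S:\mathsf MF\to\mathbb A$ such that $FS=\mathsf RF$ and the unit and associativity laws hold; sending $(F,S)$ to $\mathbb B$ gives a fibration with finite products $\mathsf R\text{-}\mathbf{Alg}\to\mathbf{Cat}$. For a small category $\mathbb B$ let $\mathrm{Iso}(\mathbb B)$ be the category of isomorphisms of $\mathbb B$ and commutative squares. The functor $\langle\mathrm{cod},\mathrm{dom}\rangle:\mathrm{Iso}(\mathbb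 B)\to\mathbb B\times\mathbb B$ is an $\mathsf R$-algebra with the structure $s_{\mathbb B}$ that sends $(y:B_1\cong B_2,\ (b_2,b_1):(B_2',B_1')\cong(B_2,B_1))$ to $b_2^{-1}yb_1:B_1'\cong B_2'$. Let $\mathrm{refl}_{\mathbb B}:\mathbb B\to\mathrm{Iso}(\mathbb B)$ send $B$ to $\mathrm{id}_B$; it gives an algebra morphism (a loop) $\delta=(\langle1,1\rangle,\mathrm{refl}_{\mathbb B}):(\mathrm{Id}_{\mathbb B},\mathsf R\,\mathrm{Id}_{\mathbb B})\to(\langle\mathrm{cod},\mathrm{dom}\rangle,s_{\mathbb B})$ over the diagonal of $\mathbb B$, whose domain is terminal in the fibre over $\mathbb B$. Let $(F:\mathbb A\to\mathbb B,\,S)$ be an $\mathsf R$-algebra, and let $P=\mathrm{pr}_1^*(F,S)\wedge(\langle\mathrm{cod},\mathrm{dom}\rangle,s_{\mathbb B})$ be the product in the fibre over $\mathbb B\times\mathbb B$. A carrier for the loop $\delta$ at $(F,S)$ is an algebra morphism $t:P\to(F,S)$ over $\mathrm{pr}_2:\mathbb B\times\mathbb B\to\mathbb B$. It is strict if $t\circ\langle\sigma,\delta\,!\rangle=\mathrm{id}_{(F,S)}$,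 where $!$ is the unique vertical morphism from $(F,S)$ to $(\mathrm{Id}_{\mathbb B},\mathsf R\,\mathrm{Id}_{\mathbb B})$, and $\sigma:(F,S)\to\mathrm{pr}_1^*(F,S)$ is the morphism over the diagonal whose composite with the cartesian arrow $\mathrm{pr}_1^*(F,S)\to(F,S)$ is the identity. **Lemma.** There is exactly one strict carrier for the loop $\delta$ at $(F,S)$. When $P$ is realised on the functor $D:\mathsf MF\to\mathbb B\times\mathbb B$, $(A,x:B\cong FA)\mapsto(FA,B)$, with the structure $((A,x),(b_1,b_2):(B_1,B_2)\cong(FA,B))\mapsto(S(A,b_1),\,b_1^{-1}xb_2)$, this carrier is $(\mathrm{pr}_2,S)$. -/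

import Mathlib

open CategoryTheory MonoidalCategory CartesianMonoidalCategory

universe u v₁ u₁ v₂ u₂

/-! The algebraic weak factorisation system of isofibrations on the category `Cat` of small
categories, its fibration of algebras, and loops and carriers in a fibration. -/

namespace CatAWFS

/-! ### The category `M F` -/

section M
variable {A B : Type u} [Category.{u} A] [Category.{u} B]

/-- An object of `M F`: a pair `(A, x : B ≅ F A)`; here `pt = A`, `base = B`, `iso = x`.
For `F = 𝟭 B` this is the category of isomorphisms of `B` and commutative squares, the
isomorphism `x : B₁ ≅ B₂` having domain `base = B₁` and codomain `pt = B₂`. -/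
@[ext]
structure M (F : A ⥤ B) : Type u where
  pt : A
  base : B
  iso : base ≅ F.obj pt

variable {F : A ⥤ B}

/-- An arrow `(b, a)` of `M F`: `b : B ⟶ B'` and `a : A ⟶ A'` with `x ≫ F a = b ≫ x'`. -/
@[ext]
structure MHom (m n : M F) : Type u where
  base : m.base ⟶ n.base
  pt : m.pt ⟶ n.pt
  w : base ≫ n.iso.hom = m.iso.hom ≫ F.map pt

instance : Category.{u} (M F) where
  Hom m n := MHom m n
  id m := { base := 𝟙 _, pt := 𝟙 _, w := by simp }
  comp f g := { base := f.base ≫ g.base, pt := f.pt ≫ g.pt, w := by rw [Category.assoc, g.w, ← Category.assoc, f.w]; simp }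

@[ext]
theorem M.hom_ext {m n : M F} {f g : m ⟶ n} (h₁ : f.base = g.base) (h₂ : f.pt = g.pt) : f = g :=
  MHom.ext h₁ h₂

@[simp] theorem M.id_base (m : M F) : MHom.base (𝟙 m) = 𝟙 m.base := rfl
@[simp] theorem M.id_pt (m : M F) : MHom.pt (𝟙 m) = 𝟙 m.pt := rfl
@[simp] theorem M.comp_base {m n k : M F} (f : m ⟶ n) (g : n ⟶ k) :
    MHom.base (f ≫ g) = f.base ≫ g.base := rfl
@[simp] theorem M.comp_pt {m n k : M F} (f : m ⟶ n) (g : n ⟶ k) :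
    MHom.pt (f ≫ g) = f.pt ≫ g.pt := rfl

variable (F) in
/-- The functor `R F : M F ⥤ B`, `(A, x : B ≅ F A) ↦ B`; for `F = 𝟭 B` it is `dom`. -/
@[simps] abbrev M.toBase : M F ⥤ B where
  obj m := m.base
  map f := f.base

variable (F) in
/-- The projection `M F ⥤ A`, `(A, x : B ≅ F A) ↦ A`; for `F = 𝟭 B` it is `cod`. -/
@[simps] abbrev M.toPt : M F ⥤ A where
  obj m := m.pt
  map f := f.pt

theorem M.obj_ext {p q : M F} (e1 : p.pt = q.pt) (e2 : p.base = q.base)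
    (h : HEq p.iso.hom q.iso.hom) : p = q := by
  obtain ⟨a, b, x⟩ := p
  obtain ⟨a', b', y⟩ := q
  dsimp at e1 e2
  subst e1 e2
  congr 1
  ext
  exact eq_of_heq h

theorem M.functor_ext {C : Type u} [Category.{u} C] {P Q : C ⥤ M F}
    (h₁ : P ⋙ M.toPt F = Q ⋙ M.toPt F) (h₂ : P ⋙ M.toBase F = Q ⋙ M.toBase F)
    (h : ∀ c, HEq (P.obj c).iso.hom (Q.obj c).iso.hom) : P = Q := by
  have hobj : ∀ c, P.obj c = Q.obj c := fun c =>
    M.obj_ext (Functor.congr_obj h₁ c) (Functor.congr_obj h₂ c) (h c)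
  have key1 : ∀ {m n : M F} (h : m = n), MHom.base (eqToHom h) = eqToHom (congrArg M.base h) := by
    rintro m _ rfl; rfl
  have key2 : ∀ {m n : M F} (h : m = n), MHom.pt (eqToHom h) = eqToHom (congrArg M.pt h) := by
    rintro m _ rfl; rfl
  refine CategoryTheory.Functor.ext hobj ?_
  intro X Y f
  apply M.hom_ext
  · rw [M.comp_base, M.comp_base, key1, key1]
    exact Functor.congr_hom h₂ f
  · rw [M.comp_pt, M.comp_pt, key2, key2]
    exact Functor.congr_hom h₁ f

/-- The functor `M F ⥤ M (𝟭 B)`, `(A, x) ↦ x`, from `M F` to the category of isomorphisms of `B`.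
Together with `M.toPt F` it exhibits `M F` as the pullback of `F` and `cod`. -/
@[simps] def M.toIso (F : A ⥤ B) : M F ⥤ M (𝟭 B) where
  obj m := ⟨F.obj m.pt, m.base, m.iso⟩
  map f := { base := f.base, pt := F.map f.pt, w := f.w }

/-- The functor into the pullback `M F` of `F` and `cod` induced by a commutative square. -/
def M.pullLift {C : Type u} [Category.{u} C] (P : C ⥤ A) (Q : C ⥤ M (𝟭 B))
    (h : P ⋙ F = Q ⋙ M.toPt (𝟭 B)) : C ⥤ M F where
  obj c := ⟨P.obj c, (Q.obj c).base, (Q.obj c).iso ≪≫ eqToIso (Functor.congr_obj h c).symm⟩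
  map {c d} g :=
    { base := (Q.map g).base
      pt := P.map g
      w := by
        have h1 : F.map (P.map g) = _ ≫ (Q.map g).pt ≫ _ := Functor.congr_hom h g
        have h2 : (Q.map g).base ≫ (Q.obj d).iso.hom = (Q.obj c).iso.hom ≫ (Q.map g).pt :=
          (Q.map g).w
        change (Q.map g).base ≫ (Q.obj d).iso.hom ≫ eqToHom (Functor.congr_obj h d).symm =
          ((Q.obj c).iso.hom ≫ eqToHom (Functor.congr_obj h c).symm) ≫ F.map (P.map g)
        rw [h1, ← Category.assoc, h2]
        simp }

theorem M.pullLift_toIso {C : Type u} [Category.{u} C] (P : C ⥤ A) (Q : C ⥤ M (𝟭 B))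
    (h : P ⋙ F = Q ⋙ M.toPt (𝟭 B)) : M.pullLift P Q h ⋙ M.toIso F = Q :=
  M.functor_ext h rfl fun c => comp_eqToHom_heq _ (Functor.congr_obj h c).symm

theorem M.pull_ext {C : Type u} [Category.{u} C] {P Q : C ⥤ M F}
    (h₁ : P ⋙ M.toPt F = Q ⋙ M.toPt F) (h₂ : P ⋙ M.toIso F = Q ⋙ M.toIso F) : P = Q :=
  M.functor_ext h₁ (congrArg (fun T => T ⋙ M.toBase (𝟭 B)) h₂) fun c =>
    congr_arg_heq (fun m : M (𝟭 B) => m.iso.hom) (Functor.congr_obj h₂ c)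

variable {A' B' : Type u} [Category.{u} A'] [Category.{u} B'] {F' : A' ⥤ B'}

/-- Functoriality of `M` on commutative squares of functors. -/
@[simps] def M.map (H : A ⥤ A') (K : B ⥤ B') (h : H ⋙ F' = F ⋙ K) : M F ⥤ M F' where
  obj m := ⟨H.obj m.pt, K.obj m.base,
    K.mapIso m.iso ≪≫ eqToIso (Functor.congr_obj h m.pt).symm⟩
  map {m n} g :=
    { base := K.map g.base
      pt := H.map g.pt
      w := by
        have h1 : F'.map (H.map g.pt) = _ := Functor.congr_hom h g.pt
        have h2 := congrArg K.map g.w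
        rw [Functor.map_comp, Functor.map_comp] at h2
        dsimp
        rw [reassoc_of% h2, h1]
        simp }

/-- The functor `L F : A ⥤ M F`, `A ↦ (A, 𝟙 (F A))`, which is the unit of the monad `R` at `F`;
for `F = 𝟭 B` it is `refl`, sending an object to its identity. -/
@[simps] def M.unit (F : A ⥤ B) : A ⥤ M F where
  obj a := ⟨a, F.obj a, Iso.refl _⟩
  map f := { base := F.map f, pt := f, w := by simp }

/-- The multiplication of `R` at `F`: `((A, x : B ≅ F A), x' : B' ≅ B) ↦ (A, x' ≫ x)`. -/
@[simps] def M.mult (F : A ⥤ B) : M (M.toBase F) ⥤ M F where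
  obj m := ⟨m.pt.pt, m.base, m.iso ≪≫ m.pt.iso⟩
  map {m n} f :=
    { base := f.base
      pt := f.pt.pt
      w := by
        have h : f.base ≫ n.iso.hom = m.iso.hom ≫ f.pt.base := f.w
        have h' := f.pt.w
        dsimp
        rw [reassoc_of% h, h']
        simp }

theorem M.map_iso_heq (H : A ⥤ A') (K : B ⥤ B') (h : H ⋙ F' = F ⋙ K) (m : M F) :
    HEq ((M.map H K h).obj m).iso.hom (K.map m.iso.hom) :=
  comp_eqToHom_heq _ (Functor.congr_obj h m.pt).symm

theorem heq_map (K : B ⥤ B') {b c b' c' : B} {f : b ⟶ c} {g : b' ⟶ c'} (h₁ : b = b')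
    (h₂ : c = c') (h : HEq f g) : HEq (K.map f) (K.map g) := by
  subst h₁ h₂; cases h; rfl

theorem heq_comp {b c d b' c' d' : B} {f : b ⟶ c} {g : c ⟶ d} {f' : b' ⟶ c'} {g' : c' ⟶ d'}
    (h₁ : b = b') (h₂ : c = c') (h₃ : d = d') (h : HEq f f') (h' : HEq g g') :
    HEq (f ≫ g) (f' ≫ g') := by
  subst h₁ h₂ h₃; cases h; cases h'; rfl

theorem M.map_id (F : A ⥤ B) : M.map (F := F) (F' := F) (𝟭 A) (𝟭 B) rfl = 𝟭 (M F) :=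
  M.functor_ext rfl rfl fun c => M.map_iso_heq _ _ _ c

theorem M.map_comp {A'' B'' : Type u} [Category.{u} A''] [Category.{u} B''] {F'' : A'' ⥤ B''}
    (H : A ⥤ A') (K : B ⥤ B') (h : H ⋙ F' = F ⋙ K)
    (H' : A' ⥤ A'') (K' : B' ⥤ B'') (h' : H' ⋙ F'' = F' ⋙ K')
    (h'' : (H ⋙ H') ⋙ F'' = F ⋙ K ⋙ K') :
    M.map (H ⋙ H') (K ⋙ K') h'' = M.map H K h ⋙ M.map H' K' h' :=
  M.functor_ext rfl rfl fun c => (M.map_iso_heq _ _ _ c).trans <| HEq.symm <|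
    (M.map_iso_heq H' K' h' _).trans <|
      heq_map K' rfl (Functor.congr_obj h c.pt) (M.map_iso_heq _ _ _ c)

theorem M.unit_naturality (H : A ⥤ A') (K : B ⥤ B') (h : H ⋙ F' = F ⋙ K) :
    H ⋙ M.unit F' = M.unit F ⋙ M.map H K h :=
  M.functor_ext rfl h fun c => HEq.symm <| (M.map_iso_heq H K h _).trans <| by
    change HEq (K.map (𝟙 (F.obj c))) (𝟙 (F'.obj (H.obj c)))
    rw [K.map_id, show F'.obj (H.obj c) = K.obj (F.obj c) from Functor.congr_obj h c]

theorem M.mult_naturality (H : A ⥤ A') (K : B ⥤ B') (h : H ⋙ F' = F ⋙ K) :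
    M.map (F := M.toBase F) (F' := M.toBase F') (M.map H K h) K rfl ⋙ M.mult F' =
      M.mult F ⋙ M.map H K h :=
  M.functor_ext rfl rfl fun c => HEq.symm <| (M.map_iso_heq H K h _).trans <| by
    change HEq (K.map (c.iso.hom ≫ c.pt.iso.hom)) _
    rw [K.map_comp]
    exact heq_comp rfl rfl (Functor.congr_obj h c.pt.pt).symm
      (M.map_iso_heq (F := M.toBase F) (F' := M.toBase F') _ _ rfl c).symm
      (M.map_iso_heq H K h c.pt).symm

theorem M.mult_assoc (F : A ⥤ B) :
    M.map (F := M.toBase (M.toBase F)) (F' := M.toBase F) (M.mult F) (𝟭 B) rfl ⋙ M.mult F =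
      M.mult (M.toBase F) ⋙ M.mult F :=
  M.functor_ext rfl rfl fun c => heq_of_eq <| by
    change (c.iso.hom ≫ 𝟙 _) ≫ c.pt.iso.hom ≫ c.pt.pt.iso.hom =
      (c.iso.hom ≫ c.pt.iso.hom) ≫ c.pt.pt.iso.hom
    rw [Category.comp_id, Category.assoc]

theorem M.unit_mult (F : A ⥤ B) : M.unit (M.toBase F) ⋙ M.mult F = 𝟭 _ :=
  M.functor_ext rfl rfl fun c => heq_of_eq (Category.id_comp c.iso.hom)

theorem M.map_unit_mult (F : A ⥤ B) :
    M.map (F := F) (F' := M.toBase F) (M.unit F) (𝟭 B) rfl ⋙ M.mult F = 𝟭 _ :=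
  M.functor_ext rfl rfl fun c => heq_of_eq <|
    (Category.comp_id _).trans (Category.comp_id c.iso.hom)

end M

/-! ### The monad `R` on the arrow category of `Cat`, and its algebras -/

theorem sq {F G : Arrow Cat.{u, u}} (f : F ⟶ G) :
   f.left.toFunctor ⋙ G.hom.toFunctor = F.hom.toFunctor ⋙ f.right.toFunctor :=
  congrArg Cat.Hom.toFunctor f.w

theorem arrow_ext {F G : Arrow Cat.{u, u}} {f g : F ⟶ G}
   (h₁ : f.left.toFunctor = g.left.toFunctor) (h₂ : f.right.toFunctor = g.right.toFunctor) : f = g :=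
  Arrow.hom_ext f g (Cat.ext h₁) (Cat.ext h₂)

/-- `R F : M F ⥤ B` as an object of the arrow category. -/
def Robj (F : Arrow Cat.{u, u}) : Arrow Cat.{u, u} :=
  Arrow.mk (M.toBase F.hom.toFunctor).toCatHom

/-- The endofunctor `R` of the arrow category of `Cat`. -/
def R : Arrow Cat.{u, u} ⥤ Arrow Cat.{u, u} where
  obj F := Robj F
  map {F G} f := Arrow.homMk (f := Robj F) (g := Robj G)
    (u := (M.map f.left.toFunctor f.right.toFunctor (sq f)).toCatHom) (v := f.right) rfl
  map_id F := arrow_ext (M.map_id F.hom.toFunctor) rfl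
  map_comp f g := arrow_ext (M.map_comp _ _ (sq f) _ _ (sq g) (sq (f ≫ g))) rfl

/-- The monad `R`, with unit `L` and multiplication `M.mult`. -/
def RMonad : Monad (Arrow Cat.{u, u}) where
  toFunctor := R
  η :=
    { app F := Arrow.homMk (f := F) (g := Robj F)
        (u := (M.unit F.hom.toFunctor).toCatHom) (v := 𝟙 F.right) rfl
      naturality _ _ f := arrow_ext (M.unit_naturality _ _ (sq f)) rfl }
  μ :=
    { app F := Arrow.homMk (f := Robj (Robj F)) (g := Robj F)
        (u := (M.mult F.hom.toFunctor).toCatHom) (v := 𝟙 F.right) rfl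
      naturality _ _ f := arrow_ext (M.mult_naturality _ _ (sq f)) rfl }
  assoc F := arrow_ext (M.mult_assoc F.hom.toFunctor) rfl
  left_unit F := arrow_ext (M.unit_mult F.hom.toFunctor) rfl
  right_unit F := arrow_ext (M.map_unit_mult F.hom.toFunctor) rfl

/-- The category `R-Alg` of algebras for the monad `R`. -/
abbrev RAlg := RMonad.{u}.Algebra

/-- The functor `R-Alg ⥤ Cat` sending an algebra `(F : A ⥤ B, S)` to `B`. -/
def algFib : RAlg.{u} ⥤ Cat.{u, u} := RMonad.{u}.forget ⋙ Arrow.rightFunc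


section Alg

/-- The structure functor `S : M F ⥤ A` of an algebra on `F : A ⥤ B`. -/
def RAlg.str (X : RAlg.{u}) : M X.A.hom.toFunctor ⥤ X.A.left := X.a.left.toFunctor

theorem RAlg.a_right (X : RAlg.{u}) : X.a.right = 𝟙 X.A.right :=
  (Category.id_comp _).symm.trans (congrArg (fun f => f.right) X.unit)

theorem RAlg.str_comp (X : RAlg.{u}) : X.str ⋙ X.A.hom.toFunctor = M.toBase X.A.hom.toFunctor := by
  have h := sq X.a
  rw [RAlg.a_right] at h
  exact h

theorem RAlg.unit_str (X : RAlg.{u}) : M.unit X.A.hom.toFunctor ⋙ X.str = 𝟭 _ :=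
  congrArg (fun f => f.left.toFunctor) X.unit

theorem M.map_congr {A B : Type u} [Category.{u} A] [Category.{u} B] {F : A ⥤ B}
    {A' B' : Type u} [Category.{u} A'] [Category.{u} B'] {F' : A' ⥤ B'}
    {H H' : A ⥤ A'} {K K' : B ⥤ B'} (h : H ⋙ F' = F ⋙ K) (h₁ : H = H') (h₂ : K = K') :
    M.map H K h = M.map H' K' (h₁ ▸ h₂ ▸ h) := by
  subst h₁ h₂; rfl

theorem RAlg.mult_str (X : RAlg.{u}) : M.mult X.A.hom.toFunctor ⋙ X.str =
    M.map (F := M.toBase X.A.hom.toFunctor) X.str (𝟭 _) X.str_comp ⋙ X.str := by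
  have h : M.mult X.A.hom.toFunctor ⋙ X.str =
    M.map (F := M.toBase X.A.hom.toFunctor) X.str X.a.right.toFunctor (sq X.a) ⋙ X.str :=
    congrArg (fun f => f.left.toFunctor) X.assoc
  exact h.trans (congrArg (fun T => T ⋙ X.str) (M.map_congr (F := M.toBase X.A.hom.toFunctor)
    (F' := X.A.hom.toFunctor) (sq X.a) rfl (congrArg Cat.Hom.toFunctor X.a_right)))

/-- An algebra `(F, S)` from functors `F : A ⥤ B` and `S : M F ⥤ A` satisfying the algebra laws. -/
def mkAlg {A B : Type u} [Category.{u} A] [Category.{u} B] (F : A ⥤ B) (S : M F ⥤ A)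
    (h : S ⋙ F = M.toBase F) (hu : M.unit F ⋙ S = 𝟭 A)
    (hm : M.mult F ⋙ S = M.map (F := M.toBase F) (F' := F) S (𝟭 B) h ⋙ S) : RAlg.{u} where
  A := Arrow.mk F.toCatHom
  a := Arrow.homMk (f := Robj (Arrow.mk F.toCatHom)) (g := Arrow.mk F.toCatHom)
    (u := S.toCatHom) (v := 𝟙 _) (Cat.ext h)
  unit := arrow_ext hu rfl
  assoc := arrow_ext hm rfl

/-- An algebra morphism `(K, H)` from a commutative square compatible with the structures. -/
def mkHom {X Y : RAlg.{u}} (H : X.A.left ⥤ Y.A.left) (K : X.A.right ⥤ Y.A.right)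
    (h : H ⋙ Y.A.hom.toFunctor = X.A.hom.toFunctor ⋙ K)
    (hs : M.map H K h ⋙ Y.str = X.str ⋙ H) : X ⟶ Y where
  f := Arrow.homMk (u := ⟨H⟩) (v := ⟨K⟩) (Cat.ext h)
  h := arrow_ext hs (by
    change K ⋙ Y.a.right.toFunctor = X.a.right.toFunctor ⋙ K
    rw [RAlg.a_right, RAlg.a_right]
    rfl)

theorem RAlg.hom_str {X Y : RAlg.{u}} (f : X ⟶ Y) :
    M.map f.f.left.toFunctor f.f.right.toFunctor (sq f.f) ⋙ Y.str = X.str ⋙ f.f.left.toFunctor :=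
  congrArg (fun f => f.left.toFunctor) f.h

theorem RAlg.hom_ext {X Y : RAlg.{u}} {f g : X ⟶ Y} (h₁ : f.f.left.toFunctor = g.f.left.toFunctor)
    (h₂ : f.f.right.toFunctor = g.f.right.toFunctor) : f = g :=
  Monad.Algebra.Hom.ext (arrow_ext h₁ h₂)

theorem prod_functor_ext {C A B : Type u} [Category.{u} C] [Category.{u} A] [Category.{u} B]
    {P Q : C ⥤ A × B} (h₁ : P ⋙ CategoryTheory.Prod.fst A B = Q ⋙ CategoryTheory.Prod.fst A B)
    (h₂ : P ⋙ CategoryTheory.Prod.snd A B = Q ⋙ CategoryTheory.Prod.snd A B) : P = Q := by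
  have e : ∀ P : C ⥤ A × B, P = (P ⋙ CategoryTheory.Prod.fst A B).prod' (P ⋙ CategoryTheory.Prod.snd A B) := fun _ => rfl
  rw [e P, e Q, h₁, h₂]

variable (B : Type u) [Category.{u} B]

/-- The category of isomorphisms of `B`. -/
abbrev IsoCat := M (𝟭 B)

/-- The functor `⟨cod, dom⟩ : IsoCat B ⥤ B × B`. -/
def endpoints : IsoCat B ⥤ B × B := (M.toPt (𝟭 B)).prod' (M.toBase (𝟭 B))

theorem conj_assoc {B : Type u} [Category.{u} B] {a b c d e f : B} (g₁ : a ⟶ b) (g₂ : b ⟶ c)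
    (x : c ⟶ d) (g₃ : d ⟶ e) (g₄ : e ⟶ f) :
    (g₁ ≫ g₂) ≫ x ≫ g₃ ≫ g₄ = (g₁ ≫ 𝟙 b) ≫ (g₂ ≫ x ≫ g₃) ≫ 𝟙 e ≫ g₄ := by
  simp

theorem conj_sq {B : Type u} [Category.{u} B] {p₁ p₂ q₁ q₂ a₁ a₂ c₁ c₂ : B}
    {f₁ : p₁ ⟶ q₁} {f₂ : p₂ ⟶ q₂} {i₁ : p₁ ≅ a₁} {i₂ : p₂ ≅ a₂} {j₁ : q₁ ≅ c₁} {j₂ : q₂ ≅ c₂}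
    {g₁ : a₁ ⟶ c₁} {g₂ : a₂ ⟶ c₂} {x : a₂ ⟶ a₁} {y : c₂ ⟶ c₁}
    (h₁ : f₁ ≫ j₁.hom = i₁.hom ≫ g₁) (h₂ : f₂ ≫ j₂.hom = i₂.hom ≫ g₂) (h : g₂ ≫ y = x ≫ g₁) :
    f₂ ≫ j₂.hom ≫ y ≫ j₁.inv = (i₂.hom ≫ x ≫ i₁.inv) ≫ f₁ := by
  have h₃ : i₁.inv ≫ f₁ = g₁ ≫ j₁.inv := by
    rw [Iso.inv_comp_eq, ← reassoc_of% h₁]; simp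
  rw [reassoc_of% h₂, reassoc_of% h]
  simp [h₃]

/-- The structure of the path object: `(y : B₁ ≅ B₂, (b₂, b₁) : (B₂', B₁') ≅ (B₂, B₁))` is sent
to the composite `b₁ ≫ y ≫ b₂⁻¹ : B₁' ≅ B₂'`. -/
def pathStr : M (endpoints B) ⥤ IsoCat B where
  obj m :=
    { pt := m.base.1
      base := m.base.2
      iso := (CategoryTheory.Prod.snd B B).mapIso m.iso ≪≫ m.pt.iso ≪≫ ((CategoryTheory.Prod.fst B B).mapIso m.iso).symm }
  map {m n} f :=
    { base := f.base.2
      pt := f.base.1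
      w := conj_sq (i₁ := (CategoryTheory.Prod.fst B B).mapIso m.iso)
        (i₂ := (CategoryTheory.Prod.snd B B).mapIso m.iso)
        (j₁ := (CategoryTheory.Prod.fst B B).mapIso n.iso)
        (j₂ := (CategoryTheory.Prod.snd B B).mapIso n.iso)
        (congrArg Prod.fst f.w) (congrArg Prod.snd f.w) f.pt.w }

/-- The algebra `(⟨cod, dom⟩, s_B)` over `B × B`. -/
def pathAlg : RAlg.{u} := mkAlg (endpoints B) (pathStr B) rfl
  (M.functor_ext rfl rfl fun c => heq_of_eq <| by
    change 𝟙 _ ≫ c.iso.hom ≫ 𝟙 _ = c.iso.hom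
    simp)
  (M.functor_ext rfl rfl fun c => heq_of_eq <| by
    change (c.iso.hom.2 ≫ c.pt.iso.hom.2) ≫ c.pt.pt.iso.hom ≫ (c.pt.iso.inv.1 ≫ c.iso.inv.1) =
     (c.iso.hom.2 ≫ 𝟙 _) ≫ (c.pt.iso.hom.2 ≫ c.pt.pt.iso.hom ≫ c.pt.iso.inv.1) ≫ 𝟙 _ ≫ c.iso.inv.1
    exact conj_assoc _ _ _ _ _)

/-- The algebra `(𝟭 B, R (𝟭 B))`. -/
def unitAlg : RAlg.{u} := mkAlg (𝟭 B) (M.toBase (𝟭 B)) rfl rfl rfl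

/-- The algebra morphism `(⟨1, 1⟩, refl) : (𝟭 B, R (𝟭 B)) ⟶ (⟨cod, dom⟩, s_B)`. -/
def reflHom : unitAlg B ⟶ pathAlg B :=
  mkHom (M.unit (𝟭 B)) ((𝟭 B).prod' (𝟭 B)) rfl
   (M.functor_ext rfl rfl fun (c : M (𝟭 B)) => heq_of_eq <| by
     change (c.iso.hom ≫ 𝟙 _) ≫ 𝟙 _ ≫ (𝟙 _ ≫ c.iso.inv) = 𝟙 c.base
     simp)


variable (X : RAlg.{u})

/-- The underlying functor `F : A ⥤ B` of an algebra. -/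
abbrev RAlg.fn : X.A.left ⥤ X.A.right := X.A.hom.toFunctor

/-- The functor `F × 1 : A × B ⥤ B × B`. -/
def reindexFn : (X.A.left × X.A.right) ⥤ (X.A.right × X.A.right) :=
  X.fn.prod (𝟭 _)

/-- The structure on `F × 1` induced by that on `F`:
`((A, B), (b₁, b₂) : (B₁, B₂) ≅ (F A, B)) ↦ (S (A, b₁), B₂)`. -/
def reindexStr : M (reindexFn X) ⥤ X.A.left × X.A.right :=
  (M.map (F := reindexFn X) (F' := X.fn) (CategoryTheory.Prod.fst _ _)
    (CategoryTheory.Prod.fst _ _) rfl ⋙ X.str).prod'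
    (M.toBase (reindexFn X) ⋙ CategoryTheory.Prod.snd _ _)

theorem str_mult_aux {A' B' : Type u} [Category.{u} A'] [Category.{u} B'] (G : A' ⥤ B')
    (S : M G ⥤ A') (h : S ⋙ G = M.toBase G) (H : A' ⥤ X.A.left) (K : B' ⥤ X.A.right)
    (hHK : H ⋙ X.fn = G ⋙ K) (hS : S ⋙ H = M.map H K hHK ⋙ X.str) :
    M.mult G ⋙ M.map H K hHK ⋙ X.str =
      M.map (F := M.toBase G) S (𝟭 B') h ⋙ M.map H K hHK ⋙ X.str := by
  have e1 := M.mult_naturality H K hHK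
  have e2 := X.mult_str
  rw [← Functor.assoc, ← e1, Functor.assoc, e2, ← Functor.assoc, ← Functor.assoc]
  congr 1
  rw [← M.map_comp (F := M.toBase G) (F' := G) (F'' := X.fn) S (𝟭 _) h H K hHK
     (by rw [Functor.assoc, hHK, ← Functor.assoc, h]; rfl)]
  rw [← M.map_comp (F := M.toBase G) (F' := M.toBase X.fn) (F'' := X.fn) (M.map H K hHK) K rfl X.str (𝟭 _)
     X.str_comp (by rw [Functor.assoc, X.str_comp]; rfl)]
  exact M.map_congr _ hS.symm rfl

theorem str_unit_aux {A' B' : Type u} [Category.{u} A'] [Category.{u} B'] {G : A' ⥤ B'}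
    (H : A' ⥤ X.A.left) (K : B' ⥤ X.A.right) (hHK : H ⋙ X.fn = G ⋙ K) :
    M.unit G ⋙ M.map H K hHK ⋙ X.str = H := by
  rw [← Functor.assoc, ← M.unit_naturality, Functor.assoc, X.unit_str]
  rfl

/-- The reindexing of the algebra `(F, S)` along the first projection `B × B ⥤ B`. -/
def reindexAlg : RAlg.{u} := mkAlg (reindexFn X) (reindexStr X)
  (prod_functor_ext
    (congrArg (fun T => M.map (F := reindexFn X) (F' := X.fn) (CategoryTheory.Prod.fst _ _)
      (CategoryTheory.Prod.fst _ _) rfl ⋙ T) X.str_comp) rfl)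
  (prod_functor_ext (str_unit_aux X (G := reindexFn X) (CategoryTheory.Prod.fst _ _)
    (CategoryTheory.Prod.fst _ _) rfl) rfl)
  (prod_functor_ext (str_mult_aux X (reindexFn X) (reindexStr X) _ (CategoryTheory.Prod.fst _ _)
    (CategoryTheory.Prod.fst _ _) rfl rfl) rfl)


/-- The functor `D : M F ⥤ B × B`, `(A, x : B ≅ F A) ↦ (F A, B)`. -/
def domainFn : M X.fn ⥤ (X.A.right × X.A.right) := (M.toPt X.fn ⋙ X.fn).prod' (M.toBase X.fn)

theorem domainStr_aux :
    (M.map (F := domainFn X) (M.toPt X.fn) (CategoryTheory.Prod.fst _ _) rfl ⋙ X.str) ⋙ X.fn =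
    (M.map (F := domainFn X) (F' := endpoints X.A.right) (M.toIso X.fn) (𝟭 _) rfl ⋙
      pathStr X.A.right) ⋙ M.toPt (𝟭 X.A.right) :=
  congrArg (fun T => M.map (F := domainFn X) (M.toPt X.fn) (CategoryTheory.Prod.fst _ _) rfl ⋙ T)
    X.str_comp

/-- The structure `S_D : M D ⥤ M F` induced by `S` and `s_B`:
`((A, x : B ≅ F A), (b₁, b₂) : (B₁, B₂) ≅ (F A, B)) ↦ (S (A, b₁), b₂ ≫ x ≫ b₁⁻¹)`. -/
def domainStr : M (domainFn X) ⥤ M X.fn :=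
  M.pullLift (M.map (F := domainFn X) (M.toPt X.fn) (CategoryTheory.Prod.fst _ _) rfl ⋙ X.str)
    (M.map (F := domainFn X) (F' := endpoints X.A.right) (M.toIso X.fn) (𝟭 _) rfl ⋙
      pathStr X.A.right) (domainStr_aux X)

theorem domainStr_toIso : domainStr X ⋙ M.toIso X.fn =
    M.map (F := domainFn X) (F' := endpoints X.A.right) (M.toIso X.fn) (𝟭 _) rfl ⋙
      pathStr X.A.right := M.pullLift_toIso _ _ (domainStr_aux X)

/-- The algebra `(D, S_D)`, the product over `B × B` of the reindexing of `(F, S)` along the first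
projection and the path object. -/
def domainAlg : RAlg.{u} := mkAlg (domainFn X) (domainStr X)
  (congrArg (fun T => T ⋙ endpoints X.A.right) (domainStr_toIso X))
  (M.pull_ext (str_unit_aux X (G := domainFn X) (M.toPt X.fn) (CategoryTheory.Prod.fst _ _) rfl) <|
    (congrArg (fun T => M.unit (domainFn X) ⋙ T) (domainStr_toIso X)).trans
    (str_unit_aux (pathAlg X.A.right) (G := domainFn X) (M.toIso X.fn) (𝟭 _) rfl))
  (M.pull_ext (str_mult_aux X (domainFn X) (domainStr X) _ (M.toPt X.fn)
    (CategoryTheory.Prod.fst _ _) rfl rfl) <|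
    (congrArg (fun T => M.mult (domainFn X) ⋙ T) (domainStr_toIso X)).trans <|
    (str_mult_aux (pathAlg X.A.right) (domainFn X) (domainStr X)
       (congrArg (fun T => T ⋙ endpoints X.A.right) (domainStr_toIso X)) (M.toIso X.fn) (𝟭 _) rfl
       (domainStr_toIso X)).trans <|
    (congrArg (fun T => M.map (F := M.toBase (domainFn X)) (F' := domainFn X) (domainStr X) (𝟭 _)
       (congrArg (fun T => T ⋙ endpoints X.A.right) (domainStr_toIso X)) ⋙ T)
       (domainStr_toIso X).symm))

end Alg

/-! ### Loops and carriers in a fibration with finite products `p : E ⥤ B` -/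

section General

open Limits

variable {E : Type u₁} [Category.{v₁} E] {B : Type u₂} [Category.{v₂} B]
  [CartesianMonoidalCategory B] {p : E ⥤ B}

variable (p) in
/-- A loop on `X`: an object `obj` over `X × X` and an arrow over the diagonal into it from the
terminal object `top` of the fibre over `X`. -/
structure Loop (X : B) where
  top : p.Fiber X
  isTerminal : IsTerminal top
  obj : p.Fiber (X ⊗ X)
  hom : top.1 ⟶ obj.1
  isHomLift : p.IsHomLift (lift (𝟙 X) (𝟙 X)) hom

/-- The product `pr₁^* A ∧ I` in the fibre over `X × X`, where `I` is the object of the loop: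
`reindex = pr₁^* A` is given by a cartesian arrow into `A` over the first projection, and `obj` is
a product of `reindex` and `I` in the fibre which is stable under reindexing, that is to say
`⟨φ₁, φ₂⟩` exists uniquely over `f` for all `φ₁` and `φ₂` over the same arrow `f`. -/
structure TransportDomain {X : B} (ℓ : Loop p X) (A : p.Fiber X) where
  reindex : p.Fiber (X ⊗ X)
  proj : reindex.1 ⟶ A.1
  cartesian : p.IsStronglyCartesian (fst X X) proj
  obj : p.Fiber (X ⊗ X)
  π₁ : obj ⟶ reindex
  π₂ : obj ⟶ ℓ.obj
  existsUnique_lift : ∀ {C : E} (f : p.obj C ⟶ X ⊗ X) (φ₁ : C ⟶ reindex.1) (φ₂ : C ⟶ ℓ.obj.1),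
    p.IsHomLift f φ₁ → p.IsHomLift f φ₂ →
      ∃! ψ : C ⟶ obj.1, p.IsHomLift f ψ ∧ ψ ≫ π₁.1 = φ₁ ∧ ψ ≫ π₂.1 = φ₂

variable {X : B} {ℓ : Loop p X} {A : p.Fiber X}

theorem TransportDomain.existsUnique_refl (D : TransportDomain ℓ A) :
    ∃! c : A.1 ⟶ D.obj.1, p.IsHomLift (lift (𝟙 X) (𝟙 X)) c ∧
      c ≫ D.π₁.1 ≫ D.proj = 𝟙 A.1 ∧ c ≫ D.π₂.1 = (ℓ.isTerminal.from A).1 ≫ ℓ.hom := by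
  obtain ⟨A, rfl⟩ := A
  have := D.cartesian
  have h1 : p.IsHomLift (lift (𝟙 (p.obj A)) (𝟙 _))
      ((ℓ.isTerminal.from ⟨A, rfl⟩).1 ≫ ℓ.hom) := by
    have := (ℓ.isTerminal.from ⟨A, rfl⟩).2
    have := ℓ.isHomLift
    infer_instance
  obtain ⟨k, ⟨hk1, hk2⟩, hk3⟩ := Functor.IsStronglyCartesian.universal_property p
    (fst (p.obj A) (p.obj A)) D.proj (lift (𝟙 _) (𝟙 _)) (𝟙 _) (by simp) (𝟙 A)
  obtain ⟨c, ⟨hc1, hc2, hc3⟩, hc4⟩ := D.existsUnique_lift _ k _ hk1 h1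
  refine ⟨c, ⟨hc1, by rw [← Category.assoc, hc2, hk2], hc3⟩, ?_⟩
  rintro c' ⟨h1, h2, h3⟩
  refine hc4 c' ⟨h1, hk3 _ ⟨?_, by rw [Category.assoc, h2]⟩, h3⟩
  have := D.π₁.2
  infer_instance

/-- The arrow `⟨σ, δ ∘ !⟩ : A ⟶ pr₁^* A ∧ I` over the diagonal, where `σ : A ⟶ pr₁^* A` is the arrow
over the diagonal with `σ ≫ proj = 𝟙 A`, and `δ` is the arrow of the loop. -/
noncomputable def TransportDomain.refl (D : TransportDomain ℓ A) : A.1 ⟶ D.obj.1 :=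
  D.existsUnique_refl.choose

/-- A carrier for the loop at `A`: an arrow `pr₁^* A ∧ I ⟶ A` over the second projection. -/
structure Carrier (D : TransportDomain ℓ A) where
  hom : D.obj.1 ⟶ A.1
  isHomLift : p.IsHomLift (snd X X) hom

/-- A carrier is strict if its composite with `A ⟶ pr₁^* A ∧ I` is the identity of `A`. -/
def Carrier.IsStrict {D : TransportDomain ℓ A} (t : Carrier D) : Prop :=
  D.refl ≫ t.hom = 𝟙 A.1

end General


/-! ### The loop on `B` and the domain of carriers at an algebra, in the fibration `algFib` -/

section Inst

open Limits

theorem homLift_iff {X Y : RAlg.{u}} (f : algFib.obj X ⟶ algFib.obj Y) (φ : X ⟶ Y) :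
    algFib.IsHomLift f φ ↔ φ.f.right = f :=
  ⟨fun _ => (IsHomLift.eq_of_isHomLift algFib f φ).symm, fun h => h ▸ IsHomLift.map algFib φ⟩

/-- `(𝟭 B, R (𝟭 B))` as an object of the fibre over `B`. -/
def unitFiber (B : Cat.{u, u}) : algFib.Fiber B := ⟨unitAlg B, rfl⟩

theorem unitFiber_existsUnique (B : Cat.{u, u}) (Y : algFib.Fiber B) :
    ∃! m : Y ⟶ unitFiber B, True := by
  obtain ⟨Y, rfl⟩ := Y
  refine ⟨⟨mkHom (Y := unitAlg Y.A.right) Y.fn (𝟭 _) rfl Y.str_comp.symm, (homLift_iff _ _).2 rfl⟩,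
    trivial, ?_⟩
  intro m _
  have h : m.1.f.right = 𝟙 _ := (homLift_iff _ _).1 m.2
  have h' := sq m.1.f
  refine Subtype.ext (RAlg.hom_ext ?_ (congrArg Cat.Hom.toFunctor h))
  rw [h] at h'
  exact h'

/-- `(𝟭 B, R (𝟭 B))` is terminal in the fibre over `B`. -/
noncomputable def unitFiberIsTerminal (B : Cat.{u, u}) : IsTerminal (unitFiber B) :=
  IsTerminal.ofUniqueHom (fun Y => (unitFiber_existsUnique B Y).choose)
    (fun Y m => (unitFiber_existsUnique B Y).choose_spec.2 m trivial)

/-- The loop `(⟨1, 1⟩, refl) : (𝟭 B, R (𝟭 B)) ⟶ (⟨cod, dom⟩, s_B)` on `B`. -/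
noncomputable def pathLoop (B : Cat.{u, u}) : Loop algFib B where
  top := unitFiber B
  isTerminal := unitFiberIsTerminal B
  obj := ⟨pathAlg B, rfl⟩
  hom := reflHom B
  isHomLift := (homLift_iff _ _).2 rfl

/-- The cartesian arrow from `reindexAlg X` to `X` over the first projection. -/
def reindexProj (X : RAlg.{u}) : reindexAlg X ⟶ X :=
  mkHom (X := reindexAlg X) (CategoryTheory.Prod.fst _ _) (CategoryTheory.Prod.fst _ _) rfl rfl

/-- The first projection of the product `domainAlg X`. -/
def domainProj₁ (X : RAlg.{u}) : domainAlg X ⟶ reindexAlg X :=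
  mkHom (X := domainAlg X) (Y := reindexAlg X) ((M.toPt X.fn).prod' (M.toBase X.fn)) (𝟭 _) rfl
    (prod_functor_ext (congrArg (fun T => T ⋙ X.str)
      (M.map_comp (F := domainFn X) (F' := reindexFn X) (F'' := X.fn)
        ((M.toPt X.fn).prod' (M.toBase X.fn)) (𝟭 _) rfl (CategoryTheory.Prod.fst _ _)
        (CategoryTheory.Prod.fst _ _) rfl rfl).symm) rfl)

/-- The second projection of the product `domainAlg X`. -/
def domainProj₂ (X : RAlg.{u}) : domainAlg X ⟶ pathAlg X.A.right :=
  mkHom (X := domainAlg X) (Y := pathAlg _) (M.toIso X.fn) (𝟭 _) rfl (domainStr_toIso X).symm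

theorem reindexProj_cartesian (X : RAlg.{u}) :
    algFib.IsStronglyCartesian (fst (algFib.obj X) (algFib.obj X)) (reindexProj X) where
  toIsHomLift := (homLift_iff (X := reindexAlg X) (Y := X) _ _).2 rfl
  universal_property' := by
    intro C g φ h
    have h : φ.f.right = g ≫ fst X.A.right X.A.right := (homLift_iff _ _).1 h
    have h1 : φ.f.left.toFunctor ⋙ X.fn =
        C.fn ⋙ g.toFunctor ⋙ CategoryTheory.Prod.fst X.A.right X.A.right :=
      (sq φ.f).trans (congrArg (fun T => C.fn ⋙ Cat.Hom.toFunctor T) h)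
    let H : C.A.left ⥤ X.A.left × X.A.right :=
      φ.f.left.toFunctor.prod' (C.fn ⋙ g.toFunctor ⋙ CategoryTheory.Prod.snd _ _)
    have hH : H ⋙ reindexFn X = C.fn ⋙ g.toFunctor := prod_functor_ext h1 rfl
    refine ⟨mkHom (X := C) (Y := reindexAlg X) H g.toFunctor hH (prod_functor_ext ?_ ?_),
      ⟨(homLift_iff _ _).2 rfl, RAlg.hom_ext rfl (congrArg Cat.Hom.toFunctor h).symm⟩, ?_⟩
    · have e := RAlg.hom_str φ
      have e' := M.map_comp (F := C.fn) (F' := reindexFn X) (F'' := X.fn) H g.toFunctor hH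
        (CategoryTheory.Prod.fst _ _) (CategoryTheory.Prod.fst _ _) rfl h1
      refine (congrArg (fun T => T ⋙ X.str) e').symm.trans (Eq.trans ?_ e)
      exact congrArg (fun T => T ⋙ X.str)
        (M.map_congr (F := C.fn) (F' := X.fn) h1 rfl (congrArg Cat.Hom.toFunctor h.symm))
    · exact congrArg (fun T => T ⋙ g.toFunctor ⋙ CategoryTheory.Prod.snd _ _) C.str_comp.symm
    · rintro ψ ⟨hψ, hψ'⟩
      have hψ : ψ.f.right = g := (homLift_iff _ _).1 hψ
      have h2 : ψ.f.left.toFunctor ⋙ reindexFn X = C.fn ⋙ g.toFunctor :=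
        (sq ψ.f).trans (congrArg (fun T => C.fn ⋙ Cat.Hom.toFunctor T) hψ)
      exact RAlg.hom_ext (prod_functor_ext (congrArg (fun T => T.f.left.toFunctor) hψ')
        (congrArg (fun T : (C.A.left ⥤ X.A.right × X.A.right) =>
          T ⋙ CategoryTheory.Prod.snd _ _) h2)) (congrArg Cat.Hom.toFunctor hψ)

theorem domain_existsUnique (X C : RAlg.{u}) (f : algFib.obj C ⟶ algFib.obj X ⊗ algFib.obj X)
    (φ₁ : C ⟶ reindexAlg X) (φ₂ : C ⟶ pathAlg X.A.right) (h₁ : algFib.IsHomLift f φ₁)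
    (h₂ : algFib.IsHomLift f φ₂) :
    ∃! ψ : C ⟶ domainAlg X, algFib.IsHomLift f ψ ∧ ψ ≫ domainProj₁ X = φ₁ ∧
      ψ ≫ domainProj₂ X = φ₂ := by
  have h₁ : φ₁.f.right = f := (homLift_iff (Y := reindexAlg X) _ _).1 h₁
  have h₂ : φ₂.f.right = f := (homLift_iff (Y := pathAlg X.A.right) _ _).1 h₂
  let K : C.A.right ⥤ X.A.right × X.A.right := f.toFunctor
  have e₁ : φ₁.f.left.toFunctor ⋙ reindexFn X = C.fn ⋙ K :=
    (sq φ₁.f).trans (congrArg (fun T => C.fn ⋙ Cat.Hom.toFunctor T) h₁)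
  have e₂ : φ₂.f.left.toFunctor ⋙ endpoints X.A.right = C.fn ⋙ K :=
    (sq φ₂.f).trans (congrArg (fun T => C.fn ⋙ Cat.Hom.toFunctor T) h₂)
  have e : (φ₁.f.left.toFunctor ⋙ CategoryTheory.Prod.fst X.A.left X.A.right) ⋙ X.fn =
      φ₂.f.left.toFunctor ⋙ M.toPt (𝟭 X.A.right) :=
    congrArg (fun T => T ⋙ CategoryTheory.Prod.fst _ _) (e₁.trans e₂.symm)
  let H : C.A.left ⥤ M X.fn := M.pullLift _ _ e
  have hI : H ⋙ M.toIso X.fn = φ₂.f.left.toFunctor := M.pullLift_toIso _ _ e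
  have hP : H ⋙ (M.toPt X.fn).prod' (M.toBase X.fn) = φ₁.f.left.toFunctor :=
    prod_functor_ext rfl (congrArg (fun T : (C.A.left ⥤ X.A.right × X.A.right) =>
      T ⋙ CategoryTheory.Prod.snd _ _) (e₂.trans e₁.symm))
  have hH : H ⋙ domainFn X = C.fn ⋙ K :=
    (congrArg (fun T => T ⋙ endpoints X.A.right) hI).trans e₂
  have key₁ : M.map H K hH ⋙
      M.map (F := domainFn X) (M.toPt X.fn) (CategoryTheory.Prod.fst _ _) rfl ⋙ X.str =
      C.str ⋙ H ⋙ M.toPt X.fn := by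
    have a := RAlg.hom_str (φ₁ ≫ reindexProj X)
    have a₁ := M.map_comp (F := C.fn) (F' := domainFn X) (F'' := X.fn) H K hH
        (M.toPt X.fn) (CategoryTheory.Prod.fst _ _) rfl
        (congrArg (fun T => T ⋙ CategoryTheory.Prod.fst _ _) hH)
    refine (congrArg (fun T => T ⋙ X.str) a₁).symm.trans (Eq.trans ?_ a)
    exact congrArg (fun T => T ⋙ X.str)
      (M.map_congr (F := C.fn) (F' := X.fn) _ rfl
        (congrArg (fun T => Cat.Hom.toFunctor T ⋙ CategoryTheory.Prod.fst _ _) h₁.symm))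
  have key₂ : M.map H K hH ⋙
      M.map (F := domainFn X) (F' := endpoints X.A.right) (M.toIso X.fn) (𝟭 _) rfl ⋙
      pathStr X.A.right = C.str ⋙ H ⋙ M.toIso X.fn := by
    have a := RAlg.hom_str φ₂
    have a₁ := M.map_comp (F := C.fn) (F' := domainFn X) (F'' := endpoints X.A.right) H
      K hH (M.toIso X.fn) (𝟭 _) rfl hH
    refine (congrArg (fun T => T ⋙ pathStr X.A.right) a₁).symm.trans (Eq.trans ?_
      (a.trans (congrArg (fun T => C.str ⋙ T) hI.symm)))
    exact congrArg (fun T => T ⋙ pathStr X.A.right)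
      (M.map_congr (F := C.fn) (F' := endpoints X.A.right) _ hI
        (congrArg (fun T => Cat.Hom.toFunctor T) h₂.symm))
  refine ⟨mkHom (X := C) (Y := domainAlg X) H K hH (M.pull_ext key₁ ?_),
    ⟨(homLift_iff (Y := domainAlg X) _ _).2 rfl,
      RAlg.hom_ext hP (congrArg Cat.Hom.toFunctor h₁.symm),
      RAlg.hom_ext hI (congrArg Cat.Hom.toFunctor h₂.symm)⟩, ?_⟩
  · exact (congrArg (fun T => M.map H K hH ⋙ T) (domainStr_toIso X)).trans key₂
  · rintro ψ ⟨a, b, c⟩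
    have a : ψ.f.right = f := (homLift_iff (Y := domainAlg X) _ _).1 a
    refine RAlg.hom_ext (M.pull_ext ?_ ?_) (congrArg Cat.Hom.toFunctor a)
    · exact congrArg (fun T => T.f.left.toFunctor ⋙ CategoryTheory.Prod.fst _ _) b
    · exact (congrArg (fun T => T.f.left.toFunctor) c).trans hI.symm

/-- The product `pr₁^* (F, S) ∧ (⟨cod, dom⟩, s_B)`, realised by the algebra `(D, S_D)` on
`D : M F ⥤ B × B`. -/
noncomputable def domain (X : RAlg.{u}) :
    TransportDomain (pathLoop (algFib.obj X)) (Functor.Fiber.mk (a := X) rfl) where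
  reindex := ⟨reindexAlg X, rfl⟩
  proj := reindexProj X
  cartesian := reindexProj_cartesian X
  obj := ⟨domainAlg X, rfl⟩
  π₁ := ⟨domainProj₁ X, (homLift_iff (X := domainAlg X) (Y := reindexAlg X) _ _).2 rfl⟩
  π₂ := ⟨domainProj₂ X, (homLift_iff (X := domainAlg X) (Y := pathAlg _) _ _).2 rfl⟩
  existsUnique_lift := domain_existsUnique X _

end Inst

end CatAWFS

/-! The fibrewise product is determined up to a vertical isomorphism that respects the two
components, hence also the arrow `refl`. It therefore suffices to treat the realisation on `D`,
where `refl` is `A ↦ (A, 𝟙 (F A))` and a carrier is a functor `T : M F ⥤ A` over the second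
projection with `S_D ⋙ T = M(T, pr₂) ⋙ S`. Strictness says that `T (A, 𝟙) = A`. Uniqueness: `S_D`
has a section `s`, sending `(A, x)` to `(A, 𝟙)` together with the isomorphism `(𝟙, x)`
(`domainSection_str`). Strictness of `T` gives `s ⋙ M(T, pr₂) = 𝟭` (`domainSection_map`), so `T = s
⋙ S_D ⋙ T = s ⋙ M(T, pr₂) ⋙ S = S`. In effect, `T` is computed by transporting `(A, 𝟙)` along `x`.
Existence: the unit law for `S` is strictness of `S`. Compatibility with the structures
(`domainStr_str`) comes from the associative law, applied twice, and the cancellation of `b₁⁻¹`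
against `b₁` in `b₂ ≫ x ≫ b₁⁻¹ ≫ b₁` (`domainSplit_mult`). -/

namespace CatAWFS

/-! ### Independence of the chosen realisation of the product -/

section General

open Limits

variable {E : Type u₁} [Category.{v₁} E] {B : Type u₂} [Category.{v₂} B]
  [CartesianMonoidalCategory B] {p : E ⥤ B} {X : B} {ℓ : Loop p X} {A : p.Fiber X}

/-- Arrows over `f : Y ⟶ X ⊗ X` into `pr₁^* A ∧ I` correspond to pairs of an arrow into `A` over
`f ≫ fst X X` and an arrow into `I` over `f`. -/
theorem TransportDomain.existsUnique_pair (D : TransportDomain ℓ A) {Y : B} {C : E}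
    (f : Y ⟶ X ⊗ X) (α : C ⟶ A.1) (β : C ⟶ ℓ.obj.1) (hα : p.IsHomLift (f ≫ fst X X) α)
    (hβ : p.IsHomLift f β) :
    ∃! ψ : C ⟶ D.obj.1, p.IsHomLift f ψ ∧ ψ ≫ D.π₁.1 ≫ D.proj = α ∧ ψ ≫ D.π₂.1 = β := by
  obtain rfl : p.obj C = Y := IsHomLift.domain_eq p f β
  have := D.cartesian
  -- The factorisation `k` of `α` through the cartesian arrow lies over `f`, as `β` does, so the two
  -- can be paired.
  obtain ⟨k, ⟨hk1, hk2⟩, hk3⟩ := Functor.IsStronglyCartesian.universal_property p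
    (fst X X) D.proj f _ rfl α
  obtain ⟨c, ⟨hc1, hc2, hc3⟩, hc4⟩ := D.existsUnique_lift f k β hk1 hβ
  refine ⟨c, ⟨hc1, by rw [← Category.assoc, hc2, hk2], hc3⟩, ?_⟩
  rintro c' ⟨h1, h2, h3⟩
  refine hc4 c' ⟨h1, hk3 _ ⟨?_, by rw [Category.assoc, h2]⟩, h3⟩
  have := D.π₁.2
  infer_instance

/-- The uniqueness half of `existsUnique_pair`, taken at the components of `ψ'`. -/
theorem TransportDomain.hom_ext (D : TransportDomain ℓ A) {Y : B} {C : E} (f : Y ⟶ X ⊗ X)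
    {ψ ψ' : C ⟶ D.obj.1} (hψ : p.IsHomLift f ψ) (hψ' : p.IsHomLift f ψ')
    (h₁ : ψ ≫ D.π₁.1 ≫ D.proj = ψ' ≫ D.π₁.1 ≫ D.proj) (h₂ : ψ ≫ D.π₂.1 = ψ' ≫ D.π₂.1) :
    ψ = ψ' := by
  have := D.cartesian
  have := D.π₁.2
  have := D.π₂.2
  have h3 : p.IsHomLift (f ≫ fst X X) (ψ' ≫ D.π₁.1 ≫ D.proj) := by
    -- Since `π₁` is vertical, the composite is found to lie over `f ≫ 𝟙 _ ≫ fst X X`; the identity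
    -- is inserted to match.
    rw [← Category.id_comp (fst X X)]
    infer_instance
  have h4 : p.IsHomLift f (ψ' ≫ D.π₂.1) := inferInstance
  exact (D.existsUnique_pair f _ _ h3 h4).unique ⟨hψ, h₁, h₂⟩ ⟨hψ', rfl, rfl⟩

/-- The comparison arrow between two realisations of `pr₁^* A ∧ I`. -/
theorem TransportDomain.exists_comparison (D D' : TransportDomain ℓ A) :
    ∃ e : D.obj.1 ⟶ D'.obj.1, p.IsHomLift (𝟙 (X ⊗ X)) e ∧
      e ≫ D'.π₁.1 ≫ D'.proj = D.π₁.1 ≫ D.proj ∧ e ≫ D'.π₂.1 = D.π₂.1 := by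
  have := D.cartesian
  have := D.π₁.2
  exact (D'.existsUnique_pair (𝟙 (X ⊗ X)) (D.π₁.1 ≫ D.proj) D.π₂.1 inferInstance D.π₂.2).exists

theorem TransportDomain.refl_spec (D : TransportDomain ℓ A) :
    p.IsHomLift (lift (𝟙 X) (𝟙 X)) D.refl ∧ D.refl ≫ D.π₁.1 ≫ D.proj = 𝟙 A.1 ∧
      D.refl ≫ D.π₂.1 = (ℓ.isTerminal.from A).1 ≫ ℓ.hom :=
  D.existsUnique_refl.choose_spec.1

theorem TransportDomain.eq_refl (D : TransportDomain ℓ A) {c : A.1 ⟶ D.obj.1}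
    (h : p.IsHomLift (lift (𝟙 X) (𝟙 X)) c) (h₁ : c ≫ D.π₁.1 ≫ D.proj = 𝟙 A.1)
    (h₂ : c ≫ D.π₂.1 = (ℓ.isTerminal.from A).1 ≫ ℓ.hom) : c = D.refl :=
  D.existsUnique_refl.choose_spec.2 c ⟨h, h₁, h₂⟩

/-- Whether there is exactly one strict carrier does not depend on the realisation of
`pr₁^* A ∧ I`. -/
theorem TransportDomain.existsUnique_strict (D D' : TransportDomain ℓ A)
    (h : ∃! t : Carrier D, t.IsStrict) : ∃! t : Carrier D', t.IsStrict := by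
  obtain ⟨e, he, he₁, he₂⟩ := D.exists_comparison D'
  obtain ⟨e', he', he'₁, he'₂⟩ := D'.exists_comparison D
  -- Comparison arrows preserve both components, so each round trip has the same components as the
  -- identity.
  have hee' : e ≫ e' = 𝟙 _ := D.hom_ext (𝟙 (X ⊗ X)) inferInstance
    (IsHomLift.id D.obj.2) (by simp [he₁, he'₁]) (by simp [he₂, he'₂])
  have he'e : e' ≫ e = 𝟙 _ := D'.hom_ext (𝟙 (X ⊗ X)) inferInstance
    (IsHomLift.id D'.obj.2) (by simp [he₁, he'₁]) (by simp [he₂, he'₂])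
  have hr := D.refl_spec.1
  have hr' : D.refl ≫ e = D'.refl := D'.eq_refl inferInstance
    (by rw [Category.assoc, he₁, D.refl_spec.2.1]) (by rw [Category.assoc, he₂, D.refl_spec.2.2])
  obtain ⟨t, ht, hu⟩ := h
  have := t.isHomLift
  -- Precomposition with `e'` and with `e` are mutually inverse bijections between the carriers for
  -- `D` and for `D'`; by `hr'` they preserve strictness.
  refine ⟨⟨e' ≫ t.hom, inferInstance⟩, ?_, ?_⟩
  · change D'.refl ≫ e' ≫ t.hom = 𝟙 A.1
    rw [← hr', Category.assoc, reassoc_of% hee']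
    exact ht
  · rintro ⟨s, hs⟩ hs'
    have h1 := hu ⟨e ≫ s, inferInstance⟩ (by
      change D.refl ≫ e ≫ s = 𝟙 A.1
      rw [← Category.assoc, hr']
      exact hs')
    subst h1
    congr 1
    change s = e' ≫ e ≫ s
    rw [reassoc_of% he'e]

end General

theorem M.pullLift_iso_heq {A B C : Type u} [Category.{u} A] [Category.{u} B] [Category.{u} C]
    {F : A ⥤ B} (P : C ⥤ A) (Q : C ⥤ M (𝟭 B)) (h : P ⋙ F = Q ⋙ M.toPt (𝟭 B)) (c : C) :
    HEq ((M.pullLift P Q h).obj c).iso.hom (Q.obj c).iso.hom :=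
  comp_eqToHom_heq _ (Functor.congr_obj h c).symm

/-- The cancellation behind existence, with `i = b₁⁻¹` and `j = b₁`. The identities are those that
the constructions `M.map` and `M.pullLift` insert. -/
theorem conj_cancel {B : Type u} [Category.{u} B] {a b c d : B} (g : a ⟶ b) (x : b ⟶ c)
    {i : c ⟶ d} {j : d ⟶ c} (h : i ≫ j = 𝟙 c) :
    (((g ≫ 𝟙 b) ≫ x ≫ 𝟙 c ≫ i) ≫ 𝟙 d) ≫ j ≫ 𝟙 c = (g ≫ 𝟙 b) ≫ x := by
  simp [h]

/-! ### Uniqueness: a section of the structure functor of the product -/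

section Inst

variable (X : RAlg.{u})

/-- The functor `M F ⥤ M D`, `(A, x : B ≅ F A) ↦ ((A, 𝟙 (F A)), (𝟙, x) : (F A, B) ≅ (F A, F A))`. -/
def domainSection : M X.fn ⥤ M (domainFn X) where
  obj m := ⟨⟨m.pt, X.fn.obj m.pt, Iso.refl _⟩, (X.fn.obj m.pt, m.base),
    Iso.prod (Iso.refl _) m.iso⟩
  map f :=
    { base := (X.fn.map f.pt, f.base)
      pt := (M.unit X.fn).map f.pt
      w := Prod.ext ((Category.comp_id _).trans (Category.id_comp _).symm) f.w }

/-- On the point this is the unit law `S (A, 𝟙) = A`; on the isomorphism, conjugating `𝟙` by `(𝟙,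
x)` gives back `x`. -/
theorem domainSection_str : domainSection X ⋙ domainStr X = 𝟭 _ := by
  refine M.pull_ext ?_ ?_
  · have h : domainSection X ⋙
        M.map (F := domainFn X) (M.toPt X.fn) (CategoryTheory.Prod.fst _ _) rfl =
        M.toPt X.fn ⋙ M.unit X.fn :=
      M.functor_ext rfl rfl fun c => heq_of_eq (Category.comp_id _)
    exact (congrArg (fun T => T ⋙ X.str) h).trans
      (congrArg (fun T => M.toPt X.fn ⋙ T) X.unit_str)
  · refine (congrArg (fun T => domainSection X ⋙ T) (domainStr_toIso X)).trans ?_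
    refine M.functor_ext rfl rfl fun c => heq_of_eq ?_
    change (c.iso.hom ≫ 𝟙 _) ≫ 𝟙 _ ≫ 𝟙 _ ≫ 𝟙 _ = c.iso.hom
    simp

/-- The point of `domainSection` lies in the image of the unit, where `T` is inverse to it, and the
second projection of `(𝟙, x)` is `x`. -/
theorem domainSection_map (T : M X.fn ⥤ X.A.left)
    (hT : T ⋙ X.fn = domainFn X ⋙ CategoryTheory.Prod.snd _ _)
    (hu : M.unit X.fn ⋙ T = 𝟭 _) :
    domainSection X ⋙ M.map (F := domainFn X) T (CategoryTheory.Prod.snd _ _) hT = 𝟭 _ :=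
  M.functor_ext (congrArg (fun T => M.toPt X.fn ⋙ T) hu) rfl fun _ =>
    M.map_iso_heq (F := domainFn X) _ _ hT _

/-- A morphism `(D, S_D) ⟶ (F, S)` over the second projection which is retracted by
`A ↦ (A, 𝟙 (F A))` is given by `S`. -/
theorem eq_str (T : M X.fn ⥤ X.A.left)
    (hT : T ⋙ X.fn = domainFn X ⋙ CategoryTheory.Prod.snd _ _)
    (hS : M.map (F := domainFn X) T (CategoryTheory.Prod.snd _ _) hT ⋙ X.str = domainStr X ⋙ T)
    (hu : M.unit X.fn ⋙ T = 𝟭 _) : T = X.str :=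
  calc T = (domainSection X ⋙ domainStr X) ⋙ T := by rw [domainSection_str]; rfl
    _ = domainSection X ⋙ M.map (F := domainFn X) T (CategoryTheory.Prod.snd _ _) hT ⋙ X.str := by
      rw [hS]; rfl
    _ = X.str := by rw [← Functor.assoc, domainSection_map X T hT hu]; rfl

/-! ### Existence: the structure functor is a morphism of algebras -/

/-- The functor sending `((A, x : B ≅ F A), (b₁, b₂) : (B₁, B₂) ≅ (F A, B))` to
`((A, b₁), b₂ ≫ x ≫ b₁⁻¹)`. -/
def domainSplit : M (domainFn X) ⥤ M (M.toBase X.fn) :=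
  M.pullLift (M.map (F := domainFn X) (M.toPt X.fn) (CategoryTheory.Prod.fst _ _) rfl)
    (M.map (F := domainFn X) (F' := endpoints X.A.right) (M.toIso X.fn) (𝟭 _) rfl ⋙
      pathStr X.A.right) rfl

/-- This isolates the use of `S` in `domainStr`, bringing `domainStr X ⋙ X.str` to the form to which
`RAlg.mult_str` applies. -/
theorem domainSplit_map :
    domainSplit X ⋙ M.map (F := M.toBase X.fn) X.str (𝟭 _) X.str_comp = domainStr X := by
  refine M.functor_ext rfl rfl fun c => ?_
  -- Both isomorphisms are `b₂ ≫ x ≫ b₁⁻¹` followed by transports along equalities of objects, hence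
  -- the heterogeneous equality.
  refine (M.map_iso_heq (F := M.toBase X.fn) _ _ X.str_comp _).trans ?_
  exact (M.pullLift_iso_heq (F := M.toBase X.fn) _ _ rfl c).trans (M.pullLift_iso_heq _ _ _ c).symm

/-- Both sides give `(A, b₂ ≫ x)`: on the left `b₁⁻¹` meets `b₁`, and on the right `b₁` is discarded
from the start. -/
theorem domainSplit_mult : domainSplit X ⋙ M.mult X.fn =
    M.map (F := domainFn X) (F' := M.toBase X.fn) (𝟭 _) (CategoryTheory.Prod.snd _ _) rfl ⋙
      M.mult X.fn := by
  refine M.functor_ext rfl rfl fun c => heq_of_eq ?_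
  exact conj_cancel c.iso.hom.2 c.pt.iso.hom (congrArg Prod.fst c.iso.inv_hom_id)

/-- Associativity turns both sides into `S (A, b₂ ≫ x)`: the left is `S` applied to `S (A, x)` and
`b₂`, the right is `S` applied to `S (A, b₁)` and `b₂ ≫ x ≫ b₁⁻¹`. -/
theorem domainStr_str : M.map (F := domainFn X) X.str (CategoryTheory.Prod.snd _ _) X.str_comp ⋙
    X.str = domainStr X ⋙ X.str := by
  have h : M.map (F := domainFn X) X.str (CategoryTheory.Prod.snd _ _) X.str_comp =
      M.map (F := domainFn X) (F' := M.toBase X.fn) (𝟭 _) (CategoryTheory.Prod.snd _ _) rfl ⋙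
        M.map (F := M.toBase X.fn) X.str (𝟭 _) X.str_comp :=
    M.map_comp (F := domainFn X) (F' := M.toBase X.fn) (𝟭 _) (CategoryTheory.Prod.snd _ _) rfl
      X.str (𝟭 _) X.str_comp X.str_comp
  rw [h, ← domainSplit_map, Functor.assoc, Functor.assoc, ← X.mult_str, ← Functor.assoc,
    ← Functor.assoc, domainSplit_mult]

/-- The algebra morphism `(pr₂, S) : (D, S_D) ⟶ (F, S)`. -/
def domainTransport : domainAlg X ⟶ X :=
  mkHom (X := domainAlg X) X.str (CategoryTheory.Prod.snd _ _) X.str_comp (domainStr_str X)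

/-! ### Strictness of the carrier and its uniqueness -/

/-- The carrier `(pr₂, S)`. -/
noncomputable def strCarrier : Carrier (domain X) where
  hom := domainTransport X
  isHomLift := (homLift_iff (X := domainAlg X) _ _).2 rfl

/-- A functor into the pullback `M F` is fixed by its components. Here they are the identity and `F`
followed by `refl`, as for `M.unit`. -/
theorem domain_refl_left : (domain X).refl.f.left.toFunctor = M.unit X.fn := by
  have h₁ := congrArg (fun f => f.f.left.toFunctor) (domain X).refl_spec.2.1
  have h₂ := congrArg (fun f => f.f.left.toFunctor) (domain X).refl_spec.2.2
  have h₃ : ((unitFiberIsTerminal (algFib.obj X)).from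
      (Functor.Fiber.mk (p := algFib) (a := X) rfl)).1.f.left.toFunctor = X.fn := by
    -- The terminal arrow comes from a choice and does not compute; but the commutative square of
    -- any vertical arrow into the identity algebra forces its upper functor to be `F`.
    generalize (unitFiberIsTerminal (algFib.obj X)).from
      (Functor.Fiber.mk (p := algFib) (a := X) rfl) = m
    have h : m.1.f.right = 𝟙 _ := (homLift_iff (X := X) (Y := unitAlg X.A.right) _ _).1 m.2
    have h' := sq m.1.f
    rw [h] at h'
    exact h'
  refine M.pull_ext h₁ (h₂.trans ?_)
  exact congrArg (fun T => T ⋙ M.unit (𝟭 _)) h₃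

theorem strCarrier_isStrict : (strCarrier X).IsStrict := by
  refine RAlg.hom_ext ?_ ?_
  · exact (congrArg (fun T => T ⋙ X.str) (domain_refl_left X)).trans X.unit_str
  -- On the base, the diagonal followed by the second projection is the identity.
  · have h : (domain X).refl.f.right = _ :=
      (homLift_iff (Y := domainAlg X) _ _).1 (domain X).refl_spec.1
    exact congrArg (fun T => Cat.Hom.toFunctor T ⋙ CategoryTheory.Prod.snd _ _) h

theorem strCarrier_unique (t : Carrier (domain X)) (ht : t.IsStrict) : t = strCarrier X := by
  obtain ⟨t, h⟩ := t
  have hr : t.f.right = _ := (homLift_iff (X := domainAlg X) _ _).1 h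
  have hT := sq t.f
  have hS := RAlg.hom_str (X := domainAlg X) t
  have hu := congrArg (fun f => f.f.left.toFunctor) ht
  -- Strictness becomes the unit condition needed by `eq_str`.
  have hu' : M.unit X.fn ⋙ t.f.left.toFunctor = 𝟭 _ :=
    (congrArg (fun T => T ⋙ t.f.left.toFunctor) (domain_refl_left X)).symm.trans hu
  have hr' : t.f.right.toFunctor = CategoryTheory.Prod.snd _ _ := congrArg Cat.Hom.toFunctor hr
  have hT' : t.f.left.toFunctor ⋙ X.fn = domainFn X ⋙ CategoryTheory.Prod.snd _ _ :=
    hT.trans (congrArg (fun T => domainFn X ⋙ T) hr')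
  -- The base functor of `t` equals the second projection only propositionally, so `M.map_congr`
  -- replaces it in the compatibility equation.
  have key := eq_str X t.f.left.toFunctor hT' ((congrArg (fun T => T ⋙ X.str)
    (M.map_congr (F := domainFn X) (F' := X.fn) hT rfl hr')).symm.trans hS) hu'
  congr 1
  exact RAlg.hom_ext (X := domainAlg X) key hr'

end Inst

end CatAWFS

/-- Let `X` be an algebra `(F : A ⥤ B, S : M F ⥤ A)`. There is exactly one strict carrier at `X` for
the loop `(⟨1, 1⟩, refl)` on `B`, whichever product `pr₁^* (F, S) ∧ (⟨cod, dom⟩, s_B)` is taken; and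
when the product is taken to be `(D : M F ⥤ B × B, S_D)` it is the arrow `S` over the second
projection. -/
theorem lemma5p6 (X : CatAWFS.RAlg.{u}) :
    (∀ D : CatAWFS.TransportDomain (CatAWFS.pathLoop (CatAWFS.algFib.obj X))
        (Functor.Fiber.mk (a := X) rfl), ∃! t : CatAWFS.Carrier D, t.IsStrict) ∧
    ∃ t : CatAWFS.Carrier (CatAWFS.domain X), t.IsStrict ∧ t.hom.f.left.toFunctor = X.str :=
  ⟨fun D => (CatAWFS.domain X).existsUnique_strict D
    ⟨CatAWFS.strCarrier X, CatAWFS.strCarrier_isStrict X, CatAWFS.strCarrier_unique X⟩,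
   CatAWFS.strCarrier X, CatAWFS.strCarrier_isStrict X, rfl⟩
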